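/- Let $d \ge 2$, let $X$ be a standard Borel space, and let $\mathbb{Z}^d$ act freely on $X$ by Borel automorphisms. Let $S \subseteq \mathbb{Z}^d$ be any finite generating set (for instance the standard one), and let $G$ be the Schreier graph of the action with respect to $S$: its vertex set is $X$, and distinct $x, y \in X$ are adjacent if and only if $y = s \cdot x$ or $x = s \cdot y$ for some $s \in S$. Then $G$ admits a Borel connected toast, that is, a Borel collection $\mathcal{T}$ of finite nonempty subsets of $X$, each inducing a connected subgraph of $G$, such that 1. every edge of $G$ has both of its endpoints in some $K \in \mathcal{T}$; 2. for all distinct $K, L \in \mathcal{T}$, either $(K \cup N(K)) \cap L = \emptyset$, or $K \cup N(K) \subseteq L$, or $L \cup N(L) \subseteq K$; 3. for every $K \in \mathcal{T}$ the subgraph of $G$ induced on $K \setminus \bigcup \{L \in \mathcal{T} : L \subsetneq K\}$ is connected. Here $N(K)$ is the set of vertices adjacent to a vertex of $K$, and $\mathcal{T}$ is Borel in the sense that for every $n$ the set of $(x_1, \dots, x_n) \in X^n$ with $\{x_1, \dots, x_n\} \in \mathcal{T}$ is Borel. -/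

import Mathlib

/-- The Schreier graph of an action of an additive group `Γ` on `X` with respect to `S ⊆ Γ`:
two distinct points are adjacent when an element of `S` moves one of them to the other. -/
def schreierGraph {Γ : Type*} (X : Type*) [AddGroup Γ] [AddAction Γ X] (S : Set Γ) :
    SimpleGraph X :=
  SimpleGraph.fromRel (fun x y => ∃ s ∈ S, s +ᵥ x = y)

/-- A collection `T` of finite subsets of `X` is Borel if, for every `n`, the set of `n`-tuples
whose underlying set belongs to `T` is Borel in `X ^ n`. This is the standard Borel structure on
the space of finite subsets of a standard Borel space (the quotient structure from tuples).
It is not the product structure on `Set X = (X → Prop)`. -/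
def IsBorelCollection {X : Type*} [MeasurableSpace X] (T : Set (Set X)) : Prop :=
  ∀ n : ℕ, MeasurableSet {p : Fin n → X | Set.range p ∈ T}

/-- The union `K ∪ N(K)` of a set of vertices with its set of neighbours. -/
def closedNeighborhood {X : Type*} (G : SimpleGraph X) (K : Set X) : Set X :=
  K ∪ {y | ∃ x ∈ K, G.Adj x y}

/-- `T` is a (Borel) connected toast in the graph `G`. -/
structure IsConnectedToast {X : Type*} [MeasurableSpace X] (G : SimpleGraph X)
    (T : Set (Set X)) : Prop where
  /-- the collection is Borel -/
  borel : IsBorelCollection T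
  /-- every tile is finite -/
  finite : ∀ K ∈ T, K.Finite
  /-- every tile is (nonempty and) connected -/
  connected : ∀ K ∈ T, (G.induce K).Connected
  /-- every edge of the graph is an edge inside some tile -/
  covers : ∀ x y : X, G.Adj x y → ∃ K ∈ T, x ∈ K ∧ y ∈ K
  /-- two different tiles are separated, or one contains the other with its neighbours -/
  nested : ∀ K ∈ T, ∀ L ∈ T, K ≠ L →
    Disjoint (closedNeighborhood G K) L ∨ closedNeighborhood G K ⊆ L ∨
      closedNeighborhood G L ⊆ K
  /-- what remains of a tile after removal of all tiles properly inside it is connected -/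
  connected_diff : ∀ K ∈ T, (G.induce (K \ ⋃₀ {L | L ∈ T ∧ L ⊂ K})).Connected

/-!
The proof works on the orbits, which are copies of `ℤ ^ d`, with the cubes of the maximum norm, and
with scales `s i` that grow geometrically.

*Markers.* Take Borel nets `D i` whose points are more than `20 * s i` apart and within `20 * s i`
of every point. Seen from a point `x` at the scale `s i`, the net `D i` meets one of finitely many
cubes of radius `s i`, so one direction `q` occurs for infinitely many `i`. Being close to `D i`
up to a fixed translation is insensitive to moving `x` in its orbit, so a direction can be chosen in
a Borel way once for each orbit, and translating `D i` by `-(s i • q)` there gives Borel sets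
`C i`, equally sparse, such that every point is within `2 * s i` of `C i` for infinitely many `i`
(`exists_marker_sequence`, an idea of Boykin and Jackson). The direction depends on all scales at
once, so `C i` is not determined by a bounded part of the orbit.

*Tiles.* The tile of level `i` at `z ∈ C i` starts from the cube of radius `3 * s i`, which
absorbs, in decreasing order of the level, cubes around the marker points of lower levels that come
too close (`absorb`). The total growth is small compared with `s i`, and afterwards a cube around a
marker point of lower level is either swallowed or avoided (`absorb_dichotomy`). The result is
thickened to make it connected in the Schreier graph (`tileBody`), and everything that it cuts off
from an outer shell of a larger cube is added (`tile`). What is left around the tile, and reachable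
from the shell, is its collar. The tile is connected, and so is the collar, because the shell
between two cubes is connected in dimension at least two (`reachableIn_of_mem_shell`); the collar
contains all neighbours outside the tile; and a tile of lower level lies, together with its collar,
inside or outside a given tile (`cube_subset_tile_or_disjoint`).

*Toast.* Nestedness follows at once, and every edge is covered since both endpoints are close to
some marker point. To see that a tile stays connected when the smaller tiles in it are removed,
remove them level by level, starting with the largest: a path through a removed tile is rerouted
through the collar of that tile (`remainder_step`). The collection is Borel because each tile is
defined from the marker sets by countable operations along the orbit of its marker point
(`orbitMeasurable_tile`).
-/

open Filter Set

open SimpleGraph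

/-! ### Cubes in the orbits -/

/-- The cube of radius `r` around `x` in the orbit of `x`: all translates of `x` by vectors whose
coordinates have absolute value at most `r`. -/
def cube (d : ℕ) {X : Type*} [AddAction (Fin d → ℤ) X] (r : ℤ) (x : X) : Set X :=
  {y | ∃ v : Fin d → ℤ, (∀ k, |v k| ≤ r) ∧ v +ᵥ x = y}

section Cube

variable {d : ℕ} {X : Type*} [AddAction (Fin d → ℤ) X] {r r' : ℤ} {x y z : X}

theorem mem_cube_self (hr : 0 ≤ r) : x ∈ cube d r x :=
  ⟨0, by simpa using fun _ => hr, zero_vadd _ x⟩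

theorem mem_cube_symm (h : y ∈ cube d r x) : x ∈ cube d r y := by
  obtain ⟨v, hv, rfl⟩ := h
  exact ⟨-v, by simpa using hv, by simp⟩

theorem mem_cube_trans (h : y ∈ cube d r x) (h' : z ∈ cube d r' y) : z ∈ cube d (r + r') x := by
  obtain ⟨v, hv, rfl⟩ := h
  obtain ⟨w, hw, rfl⟩ := h'
  refine ⟨w + v, fun k => ?_, add_vadd w v x⟩
  have := abs_add_le (w k) (v k)
  have h1 := hv k
  have h2 := hw k
  simp only [Pi.add_apply]
  linarith

theorem cube_mono (h : r ≤ r') : cube d r x ⊆ cube d r' x := by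
  rintro _ ⟨v, hv, rfl⟩
  exact ⟨v, fun k => (hv k).trans h, rfl⟩

theorem vadd_eq_vadd_iff_of_free (hfree : ∀ (g : Fin d → ℤ) (x : X), g +ᵥ x = x → g = 0)
    {g h : Fin d → ℤ} : g +ᵥ x = h +ᵥ x ↔ g = h := by
  refine ⟨fun hgh => ?_, fun hgh => by rw [hgh]⟩
  exact (neg_add_eq_zero.1 (hfree (-h + g) x (by rw [add_vadd, hgh, neg_vadd_vadd]))).symm

theorem vadd_mem_cube_iff (hfree : ∀ (g : Fin d → ℤ) (x : X), g +ᵥ x = x → g = 0)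
    {g h : Fin d → ℤ} : h +ᵥ x ∈ cube d r (g +ᵥ x) ↔ ∀ k, |(h - g) k| ≤ r := by
  constructor
  · rintro ⟨v, hv, hvx⟩
    rw [← add_vadd, vadd_eq_vadd_iff_of_free hfree] at hvx
    rwa [← hvx, add_sub_cancel_right]
  · intro hv
    exact ⟨_, hv, by rw [← add_vadd, sub_add_cancel]⟩

theorem finite_setOf_abs_le (d : ℕ) (r : ℤ) : {v : Fin d → ℤ | ∀ k, |v k| ≤ r}.Finite := by
  have : {v : Fin d → ℤ | ∀ k, |v k| ≤ r} = Set.univ.pi fun _ => Set.Icc (-r) r := by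
    ext v; simp [abs_le, Pi.le_def, forall_and]
  rw [this]
  exact Set.Finite.pi fun _ => Set.finite_Icc _ _

theorem finite_cube : (cube d r x).Finite :=
  ((finite_setOf_abs_le d r).image fun v => v +ᵥ x).subset fun _ ⟨v, hv, h⟩ => ⟨v, hv, h⟩

end Cube

/-! ### Borel marker sets -/

/-- A countable cover by Borel sets that are independent with respect to `F` yields a maximal
Borel set that is independent with respect to `F`, by the greedy algorithm. -/
theorem exists_maximal_independent_of_cover {Γ X : Type*} [AddGroup Γ] [AddAction Γ X]
    [MeasurableSpace X] (hmeas : ∀ g : Γ, Measurable fun x : X => g +ᵥ x)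
    {F : Set Γ} (hF : F.Countable) (hneg : ∀ g ∈ F, -g ∈ F) (A : ℕ → Set X)
    (hA : ∀ n, MeasurableSet (A n)) (hind : ∀ n, ∀ x ∈ A n, ∀ g ∈ F, g +ᵥ x ∉ A n)
    (hcov : ∀ x, ∃ n, x ∈ A n) :
    ∃ C : Set X, MeasurableSet C ∧ (∀ x ∈ C, ∀ g ∈ F, g +ᵥ x ∉ C) ∧
      ∀ x, x ∈ C ∨ ∃ g ∈ F, g +ᵥ x ∈ C := by
  let M : ℕ → Set X := fun n => Nat.rec ∅ (fun n M => M ∪ (A n \ ⋃ g ∈ F, (g +ᵥ ·) ⁻¹' M)) n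
  have hM : ∀ n, M (n + 1) = M n ∪ (A n \ ⋃ g ∈ F, (g +ᵥ ·) ⁻¹' M n) := fun n => rfl
  have hmono : Monotone M := monotone_nat_of_le_succ fun n => by rw [hM]; exact subset_union_left
  have hMm : ∀ n, MeasurableSet (M n) := by
    intro n
    induction n with
    | zero => exact MeasurableSet.empty
    | succ n ih =>
      rw [hM]
      exact ih.union ((hA n).diff (MeasurableSet.biUnion hF fun g _ => hmeas g ih))
  have hMi : ∀ n, ∀ x ∈ M n, ∀ g ∈ F, g +ᵥ x ∉ M n := by
    intro n
    induction n with
    | zero => intro x hx; exact hx.elim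
    | succ n ih =>
      intro x hx g hg hgx
      rw [hM] at hx hgx
      rcases hx with hx | ⟨hx, hx'⟩ <;> rcases hgx with hgx | ⟨hgx, hgx'⟩
      · exact ih x hx g hg hgx
      · refine hgx' (mem_iUnion₂.2 ⟨-g, hneg g hg, ?_⟩)
        simpa using hx
      · exact hx' (mem_iUnion₂.2 ⟨g, hg, hgx⟩)
      · exact hind n x hx g hg hgx
  refine ⟨⋃ n, M n, MeasurableSet.iUnion hMm, ?_, fun x => ?_⟩
  · intro x hx g hg hgx
    obtain ⟨m, hm⟩ := mem_iUnion.1 hx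
    obtain ⟨n, hn⟩ := mem_iUnion.1 hgx
    exact hMi (max m n) x (hmono (le_max_left _ _) hm) g hg (hmono (le_max_right _ _) hn)
  · obtain ⟨n, hn⟩ := hcov x
    by_cases h : x ∈ ⋃ g ∈ F, (g +ᵥ ·) ⁻¹' M n
    · obtain ⟨g, hg, h⟩ := mem_iUnion₂.1 h
      exact Or.inr ⟨g, hg, mem_iUnion.2 ⟨n, h⟩⟩
    · exact Or.inl (mem_iUnion.2 ⟨n + 1, by rw [hM]; exact Or.inr ⟨hn, h⟩⟩)

/-- For a fixed-point free finite set `F` of group elements, the points are covered by countably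
many Borel sets that are independent with respect to `F`: a point is sorted according to an
initial segment of its code in `ℕ → Bool` that is long enough to tell it from its
`F`-translates. -/
theorem exists_independent_cover {Γ X : Type*} [AddGroup Γ] [AddAction Γ X]
    [MeasurableSpace X] [StandardBorelSpace X] (hmeas : ∀ g : Γ, Measurable fun x : X => g +ᵥ x)
    {F : Set Γ} (hF : F.Finite) (hfree : ∀ g ∈ F, ∀ x : X, g +ᵥ x ≠ x) :
    ∃ A : ℕ → Set X, (∀ n, MeasurableSet (A n)) ∧
      (∀ n, ∀ x ∈ A n, ∀ g ∈ F, g +ᵥ x ∉ A n) ∧ ∀ x, ∃ n, x ∈ A n := by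
  obtain ⟨f, hf, hinj⟩ := MeasurableSpace.measurable_injection_nat_bool_of_countablySeparated X
  let B : (Σ n : ℕ, Fin n → Bool) → Set X := fun w => {x | ∀ i : Fin w.1, f x i = w.2 i}
  have hB : ∀ w, MeasurableSet (B w) := fun w => by
    have : B w = ⋂ i, (fun x => f x (i : Fin w.1)) ⁻¹' {w.2 i} := by ext; simp [B]
    rw [this]
    exact MeasurableSet.iInter fun i => (measurable_pi_apply _).comp hf (measurableSet_singleton _)
  let A : (Σ n : ℕ, Fin n → Bool) → Set X := fun w => B w \ ⋃ g ∈ F, (g +ᵥ ·) ⁻¹' B w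
  obtain ⟨e, he⟩ := exists_surjective_nat (Σ n : ℕ, Fin n → Bool)
  refine ⟨fun n => A (e n), fun n => ?_, fun n x hx g hg hgx => ?_, fun x => ?_⟩
  · exact (hB _).diff (MeasurableSet.biUnion hF.countable fun g _ => hmeas g (hB _))
  · exact hx.2 (mem_iUnion₂.2 ⟨g, hg, hgx.1⟩)
  · have h1 : ∀ g ∈ F, ∃ i, f (g +ᵥ x) i ≠ f x i := fun g hg => by
      by_contra! h
      exact hfree g hg x (hinj (funext h))
    choose! i hi using h1
    obtain ⟨N, hN⟩ := (hF.image i).bddAbove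
    obtain ⟨n, hn⟩ := he ⟨N + 1, fun k => f x k⟩
    refine ⟨n, ?_⟩
    simp only [hn, A]
    refine ⟨fun _ => rfl, fun h => ?_⟩
    obtain ⟨g, hg, h⟩ := mem_iUnion₂.1 h
    exact hi g hg (h ⟨i g, Nat.lt_succ_of_le (hN (mem_image_of_mem i hg))⟩)

/-- There is a Borel set of points that are pairwise farther than `r` apart and within `r` of
every point. -/
theorem exists_borel_net {d : ℕ} {X : Type*} [AddAction (Fin d → ℤ) X] [MeasurableSpace X]
    [StandardBorelSpace X]
    (hmeas : ∀ g : Fin d → ℤ, Measurable fun x : X => g +ᵥ x)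
    (hfree : ∀ (g : Fin d → ℤ) (x : X), g +ᵥ x = x → g = 0) {r : ℤ} (hr : 0 ≤ r) :
    ∃ C : Set X, MeasurableSet C ∧ (∀ x ∈ C, ∀ y ∈ C, y ∈ cube d r x → x = y) ∧
      ∀ x, ∃ y ∈ C, y ∈ cube d r x := by
  let F : Set (Fin d → ℤ) := {v | ∀ k, |v k| ≤ r} \ {0}
  have hF : F.Finite := (finite_setOf_abs_le d r).subset sdiff_subset
  obtain ⟨A, hA, hind, hcov⟩ := exists_independent_cover hmeas hF
    fun g hg x h => hg.2 (hfree g x h)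
  obtain ⟨C, hC, hCi, hCm⟩ := exists_maximal_independent_of_cover hmeas hF.countable
    (fun g hg => ⟨by simpa using hg.1, by simpa using hg.2⟩) A hA hind hcov
  refine ⟨C, hC, ?_, fun x => ?_⟩
  · rintro x hx _ hy ⟨v, hv, rfl⟩
    by_contra hne
    refine hCi x hx v ⟨hv, fun h => hne ?_⟩ hy
    rw [mem_singleton_iff.1 h, zero_vadd]
  · rcases hCm x with h | ⟨g, hg, h⟩
    · exact ⟨x, h, mem_cube_self hr⟩
    · exact ⟨_, h, g, hg.1, rfl⟩

/-- `x` is a *cluster point in direction* `q` of the sets `C i` at the scales `s i` if, seen from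
some point of its orbit, `C i` meets the cube of radius `s i` around the vector `s i • q` for
infinitely many `i`. This depends only on the orbit of `x`. -/
def ClustersAlong {d : ℕ} {X : Type*} [AddAction (Fin d → ℤ) X] (s : ℕ → ℤ) (C : ℕ → Set X)
    (q : Fin d → ℤ) (x : X) : Prop :=
  ∃ g : Fin d → ℤ, ∃ᶠ i in atTop, ∃ v : Fin d → ℤ, (∀ k, |v k| ≤ s i) ∧
    (v + s i • q + g) +ᵥ x ∈ C i

theorem clustersAlong_vadd {d : ℕ} {X : Type*} [AddAction (Fin d → ℤ) X]
    {s : ℕ → ℤ} {C : ℕ → Set X} {q : Fin d → ℤ} {x : X}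
    (h : Fin d → ℤ) : ClustersAlong s C q (h +ᵥ x) ↔ ClustersAlong s C q x := by
  constructor
  · rintro ⟨g, hg⟩
    refine ⟨g + h, hg.mono ?_⟩
    rintro i ⟨v, hv, hi⟩
    exact ⟨v, hv, by rwa [← add_assoc, add_vadd]⟩
  · rintro ⟨g, hg⟩
    refine ⟨g - h, hg.mono ?_⟩
    rintro i ⟨v, hv, hi⟩
    refine ⟨v, hv, ?_⟩
    rwa [← add_vadd, add_assoc, sub_add_cancel]

theorem measurableSet_clustersAlong {d : ℕ} {X : Type*} [AddAction (Fin d → ℤ) X]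
    [MeasurableSpace X] (hmeas : ∀ g : Fin d → ℤ, Measurable fun x : X => g +ᵥ x)
    (s : ℕ → ℤ) {C : ℕ → Set X} (hC : ∀ i, MeasurableSet (C i)) (q : Fin d → ℤ) :
    MeasurableSet {x | ClustersAlong s C q x} := by
  simp only [ClustersAlong, frequently_atTop]
  refine measurableSet_setOfPred.2 ?_
  refine Measurable.exists fun g => Measurable.forall fun a => Measurable.exists fun b => ?_
  refine (measurable_const (a := b ≥ a)).and (Measurable.exists fun v => ?_)
  exact measurable_const.and (measurableSet_setOfPred.1 (hmeas _ (hC b)))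

/-- Some direction exists by the pigeonhole principle: only finitely many vectors `q` are needed
to cover the cube of radius `20 * s i` by translates `s i • q` of a cube of radius `s i`. -/
theorem exists_clustersAlong {d : ℕ} {X : Type*} [AddAction (Fin d → ℤ) X]
    {s : ℕ → ℤ} (hs : ∀ i, 0 < s i) {C : ℕ → Set X}
    (hC : ∀ i x, ∃ y ∈ C i, y ∈ cube d (20 * s i) x) (x : X) :
    ∃ q : Fin d → ℤ, ClustersAlong s C q x := by
  have key : ∃ᶠ i in atTop, ∃ q ∈ {q : Fin d → ℤ | ∀ k, |q k| ≤ 20}, ∃ v : Fin d → ℤ,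
      (∀ k, |v k| ≤ s i) ∧ (v + s i • q + 0) +ᵥ x ∈ C i := by
    refine Eventually.frequently (Eventually.of_forall fun i => ?_)
    obtain ⟨_, hy, w, hw, rfl⟩ := hC i x
    refine ⟨fun k => w k / s i, fun k => ?_, fun k => w k % s i, fun k => ?_, ?_⟩
    · have h := abs_le.1 (hw k)
      refine abs_le.2 ⟨?_, ?_⟩
      · exact (Int.le_ediv_iff_mul_le (hs i)).2 (by linarith)
      · exact (Int.ediv_le_iff_le_mul (hs i)).2 (by linarith [hs i])
    · rw [abs_of_nonneg (Int.emod_nonneg _ (hs i).ne')]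
      exact (Int.emod_lt_of_pos _ (hs i)).le
    · convert hy using 2
      ext k
      simpa using Int.emod_add_mul_ediv (w k) (s i)
  obtain ⟨q, -, hq⟩ := (frequently_exists_finite (finite_setOf_abs_le d 20)).1 key
  exact ⟨q, 0, hq⟩

/-- The Boykin–Jackson marker sequence: Borel sets `C i` of points farther than `20 * s i` apart,
such that every point is within `2 * s i` of `C i` for infinitely many `i`. It is obtained from
arbitrary nets by a translation by `-(s i • q)` on each orbit, with `q` the first direction in
which the nets cluster there. -/
theorem exists_marker_sequence {d : ℕ} {X : Type*} [AddAction (Fin d → ℤ) X] [MeasurableSpace X]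
    [StandardBorelSpace X]
    (hmeas : ∀ g : Fin d → ℤ, Measurable fun x : X => g +ᵥ x)
    (hfree : ∀ (g : Fin d → ℤ) (x : X), g +ᵥ x = x → g = 0) {s : ℕ → ℤ} (hs : ∀ i, 0 < s i)
    (hlim : Tendsto s atTop atTop) :
    ∃ C : ℕ → Set X, (∀ i, MeasurableSet (C i)) ∧
      (∀ i, ∀ x ∈ C i, ∀ y ∈ C i, y ∈ cube d (20 * s i) x → x = y) ∧
      ∀ x, ∃ᶠ i in atTop, ∃ y ∈ C i, y ∈ cube d (2 * s i) x := by
  choose D hDm hDs hDc using fun i =>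
    exists_borel_net hmeas hfree (show 0 ≤ 20 * s i by linarith [hs i])
  obtain ⟨e, he⟩ := exists_surjective_nat (Fin d → ℤ)
  -- the orbits on which `e n` is the first direction
  let Y : ℕ → Set X := fun n =>
    {x | ClustersAlong s D (e n) x ∧ ∀ m < n, ¬ ClustersAlong s D (e m) x}
  have hYm : ∀ n, MeasurableSet (Y n) := fun n => by
    refine measurableSet_setOfPred.2 (Measurable.and
      (measurableSet_setOfPred.1 (measurableSet_clustersAlong hmeas s hDm _))
      (Measurable.forall fun m => measurable_const.imp
      (measurableSet_setOfPred.1 (measurableSet_clustersAlong hmeas s hDm _)).not))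
  have hYinv : ∀ n (g : Fin d → ℤ) x, g +ᵥ x ∈ Y n ↔ x ∈ Y n := fun n g x => by
    simp only [Y, mem_ofPred_eq, clustersAlong_vadd]
  have hYuniq : ∀ m n x, x ∈ Y m → x ∈ Y n → m = n := fun m n x hm hn => by
    rcases lt_trichotomy m n with h | h | h
    · exact (hn.2 m h hm.1).elim
    · exact h
    · exact (hm.2 n h hn.1).elim
  have hYex : ∀ x, ∃ n, x ∈ Y n := fun x => by
    classical
    obtain ⟨q, hq⟩ := exists_clustersAlong hs hDc x
    obtain ⟨n, rfl⟩ := he q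
    have hex : ∃ n, ClustersAlong s D (e n) x := ⟨n, hq⟩
    exact ⟨Nat.find hex, Nat.find_spec hex, fun m hm => Nat.find_min hex hm⟩
  refine ⟨fun i => ⋃ n, Y n ∩ (s i • e n +ᵥ ·) ⁻¹' D i, fun i => ?_, fun i => ?_, fun x => ?_⟩
  · exact MeasurableSet.iUnion fun n => (hYm n).inter (hmeas _ (hDm i))
  · rintro x hx _ hy ⟨v, hv, rfl⟩
    obtain ⟨m, hm, hx⟩ := mem_iUnion.1 hx
    obtain ⟨n, hn, hy⟩ := mem_iUnion.1 hy
    obtain rfl := hYuniq m n x hm ((hYinv n v x).1 hn)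
    have := hDs i _ hx _ hy ⟨v, hv, vadd_comm v _ x⟩
    exact (vadd_left_cancel_iff _).1 this
  · obtain ⟨n, hn⟩ := hYex x
    obtain ⟨g, hg⟩ := hn.1
    have hbig : ∀ᶠ i in atTop, ∀ k, |g k| ≤ s i :=
      eventually_all.2 fun k => hlim.eventually_ge_atTop _
    refine (hg.and_eventually hbig).mono ?_
    rintro i ⟨⟨v, hv, hi⟩, hgi⟩
    refine ⟨(v + g) +ᵥ x, mem_iUnion.2 ⟨n, (hYinv n _ x).2 hn, ?_⟩, v + g, fun k => ?_, rfl⟩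
    · rw [mem_preimage, ← add_vadd]
      convert hi using 2
      abel
    · have := abs_add_le (v k) (g k)
      have h1 := hv k
      have h2 := hgi k
      simp only [Pi.add_apply]
      linarith

/-! ### Reachability inside a set of vertices -/

/-- `a` and `b` are joined by a path of `G` all of whose edges have both endpoints in `V`.
Every vertex is joined to itself by the empty path, whether or not it lies in `V`. -/
def SimpleGraph.ReachableIn {X : Type*} (G : SimpleGraph X) (V : Set X) : X → X → Prop :=
  Relation.ReflTransGen fun a b => G.Adj a b ∧ a ∈ V ∧ b ∈ V

namespace SimpleGraph.ReachableIn

variable {X : Type*} {G : SimpleGraph X} {V W : Set X} {a b c : X}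

theorem refl : G.ReachableIn V a a := Relation.ReflTransGen.refl

theorem single (h : G.Adj a b) (ha : a ∈ V) (hb : b ∈ V) : G.ReachableIn V a b :=
  Relation.ReflTransGen.single ⟨h, ha, hb⟩

theorem trans (h : G.ReachableIn V a b) (h' : G.ReachableIn V b c) : G.ReachableIn V a c :=
  Relation.ReflTransGen.trans h h'

theorem symm (h : G.ReachableIn V a b) : G.ReachableIn V b a := by
  induction h with
  | refl => exact refl
  | tail _ h ih => exact (single h.1.symm h.2.2 h.2.1).trans ih

theorem mono (hVW : V ⊆ W) (h : G.ReachableIn V a b) : G.ReachableIn W a b :=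
  Relation.ReflTransGen.mono (fun _ _ h => ⟨h.1, hVW h.2.1, hVW h.2.2⟩) _ _ h

theorem mem (h : G.ReachableIn V a b) (ha : a ∈ V) : b ∈ V := by
  induction h with
  | refl => exact ha
  | tail _ h _ => exact h.2.2

/-- A set that no edge of `V` leaves contains all paths in `V` that start in it. -/
theorem of_closed (hW : ∀ x ∈ W, ∀ y, G.Adj x y → x ∈ V → y ∈ V → y ∈ W)
    (h : G.ReachableIn V a b) (ha : a ∈ W) : G.ReachableIn W a b ∧ b ∈ W := by
  induction h with
  | refl => exact ⟨refl, ha⟩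
  | tail _ h ih =>
    have := hW _ ih.2 _ h.1 h.2.1 h.2.2
    exact ⟨ih.1.trans (single h.1 ih.2 this), this⟩

theorem induce_connected (hne : V.Nonempty) (h : ∀ a ∈ V, ∀ b ∈ V, G.ReachableIn V a b) :
    (G.induce V).Connected := by
  have key : ∀ a b, G.ReachableIn V a b → ∀ (ha : a ∈ V) (hb : b ∈ V),
      (G.induce V).Reachable ⟨a, ha⟩ ⟨b, hb⟩ := by
    intro a b hab ha
    induction hab with
    | refl => exact fun _ => Reachable.refl _
    | tail _ h ih =>
      exact fun hb => (ih h.2.1).trans (Adj.reachable (G := G.induce V) (by simpa using h.1))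
  exact (connected_iff _).2 ⟨fun a b => key a b (h a a.2 b b.2) a.2 b.2, hne.to_subtype⟩

end SimpleGraph.ReachableIn

/-! ### Graphs that look like the lattice on a large scale -/

/-- A graph on `X` resembles the lattice up to the scale `c`: edges have length at most `c`, and
the lattice boxes in the orbits are connected in the graph as soon as they are thickened
by `c`. -/
structure IsLatticeLike (d : ℕ) {X : Type*} [AddAction (Fin d → ℤ) X] (G : SimpleGraph X)
    (c : ℤ) : Prop where
  pos : 0 < c
  mem_cube_of_adj : ∀ x y, G.Adj x y → y ∈ cube d c x
  reachableIn : ∀ (p q : Fin d → ℤ) (x : X) (V : Set X),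
    (∀ v ∈ uIcc p q, cube d c (v +ᵥ x) ⊆ V) → G.ReachableIn V (p +ᵥ x) (q +ᵥ x)

section Schreier

variable {d : ℕ} {X : Type*} [AddAction (Fin d → ℤ) X]

theorem apply_mem_uIcc {p q v : Fin d → ℤ} (hv : v ∈ uIcc p q) (k : Fin d) :
    v k ∈ uIcc (p k) (q k) := by
  rw [← Set.pi_univ_uIcc] at hv
  exact hv k (mem_univ k)

theorem abs_apply_le_of_mem_uIcc {p q v : Fin d → ℤ} {r : ℤ} (hp : ∀ k, |p k| ≤ r)
    (hq : ∀ k, |q k| ≤ r) (hv : v ∈ uIcc p q) (k : Fin d) : |v k| ≤ r := by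
  have h1 := mem_uIcc.1 (apply_mem_uIcc hv k)
  have h2 := abs_le.1 (hp k)
  have h3 := abs_le.1 (hq k)
  exact abs_le.2 (by omega)

theorem exists_forall_abs_le (v : Fin d → ℤ) : ∃ r : ℤ, 0 ≤ r ∧ ∀ k, |v k| ≤ r :=
  ⟨∑ k, |v k|, Finset.sum_nonneg fun _ _ => abs_nonneg _, fun k =>
    Finset.single_le_sum (f := fun k => |v k|) (fun _ _ => abs_nonneg _) (Finset.mem_univ k)⟩

/-- In the Schreier graph of a generating set, the translation by a fixed vector is realized by
paths of bounded extent. -/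
theorem exists_reachableIn_cube {S : Set (Fin d → ℤ)} (hgen : AddSubgroup.closure S = ⊤)
    (g : Fin d → ℤ) :
    ∃ r : ℤ, 0 ≤ r ∧ ∀ x : X, (schreierGraph X S).ReachableIn (cube d r x) x (g +ᵥ x) := by
  have hg : g ∈ AddSubgroup.closure S := hgen ▸ AddSubgroup.mem_top g
  induction hg using AddSubgroup.closure_induction with
  | mem s hs =>
    obtain ⟨r, hr, hsr⟩ := exists_forall_abs_le s
    refine ⟨r, hr, fun x => ?_⟩
    by_cases hx : x = s +ᵥ x
    · rw [← hx]
      exact ReachableIn.refl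
    · refine ReachableIn.single ?_ (mem_cube_self hr) ⟨s, hsr, rfl⟩
      exact (SimpleGraph.fromRel_adj _ _ _).2 ⟨hx, Or.inl ⟨s, hs, rfl⟩⟩
  | zero => exact ⟨0, le_rfl, fun x => by rw [zero_vadd]; exact ReachableIn.refl⟩
  | add g h _ _ ihg ihh =>
    obtain ⟨r, hr, hgr⟩ := ihg
    obtain ⟨r', hr', hhr⟩ := ihh
    obtain ⟨t, ht, hht⟩ := exists_forall_abs_le h
    refine ⟨t + (r + r'), by linarith, fun x => ?_⟩
    rw [add_vadd]
    refine ((hhr x).mono (cube_mono (by linarith))).trans ((hgr _).mono fun y hy => ?_)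
    exact cube_mono (by linarith) (mem_cube_trans ⟨h, hht, rfl⟩ hy)
  | neg g _ ih =>
    obtain ⟨r, hr, hgr⟩ := ih
    obtain ⟨t, ht, hgt⟩ := exists_forall_abs_le g
    refine ⟨t + r, by linarith, fun x => ?_⟩
    have := (hgr (-g +ᵥ x)).symm
    rw [vadd_neg_vadd] at this
    exact this.mono fun y hy => mem_cube_trans ⟨-g, by simpa using hgt, rfl⟩ hy

theorem isLatticeLike_of_unit_steps {G : SimpleGraph X} {c : ℤ} (hc : 0 < c)
    (hadj : ∀ x y, G.Adj x y → y ∈ cube d c x)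
    (hstep : ∀ (k : Fin d) (x : X),
      G.ReachableIn (cube d c x ∩ cube d c ((Pi.single k 1 : Fin d → ℤ) +ᵥ x)) x
        ((Pi.single k 1 : Fin d → ℤ) +ᵥ x)) :
    IsLatticeLike d G c := by
  refine ⟨hc, hadj, fun p q x V hV => ?_⟩
  induction hn : ∑ k, |p k - q k| using Int.strongRec (m := 0) generalizing p with
  | lt n hneg =>
    have : 0 ≤ ∑ k, |p k - q k| := Finset.sum_nonneg fun _ _ => abs_nonneg _
    omega
  | ge n _ ih =>
    by_cases hpq : p = q
    · rw [hpq]; exact ReachableIn.refl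
    obtain ⟨k, hk⟩ := Function.ne_iff.1 hpq
    -- move the coordinate `k` of `p` one step towards `q`
    have key : ∀ e : ℤ, |p k + e - q k| < |p k - q k| → p k + e ∈ uIcc (p k) (q k) →
        G.ReachableIn V (p +ᵥ x) ((p + Pi.single k e) +ᵥ x) →
        G.ReachableIn V (p +ᵥ x) (q +ᵥ x) := by
      intro e he hmem hr
      have hsub : p + Pi.single k e ∈ uIcc p q := by
        rw [← Set.pi_univ_uIcc]
        intro j _
        by_cases hj : j = k
        · subst hj; simpa using hmem
        · simp [hj]
      refine hr.trans (ih _ ?_ _ (fun v hv => hV v (uIcc_subset_uIcc hsub right_mem_uIcc hv)) rfl)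
      rw [← hn]
      refine Finset.sum_lt_sum (fun j _ => ?_) ⟨k, Finset.mem_univ k, by simpa using he⟩
      by_cases hj : j = k
      · subst hj; simpa using he.le
      · simp [hj]
    rcases lt_or_gt_of_ne hk with h | h
    · refine key 1 ?_ ?_ ?_
      · rw [abs_of_nonpos (by omega), abs_of_neg (by omega)]; omega
      · rw [uIcc_of_le h.le]; exact ⟨by omega, by omega⟩
      · have := (hstep k (p +ᵥ x)).mono (inter_subset_left.trans (hV p left_mem_uIcc))
        rwa [← add_vadd, add_comm] at this
    · refine key (-1) ?_ ?_ ?_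
      · rw [abs_of_nonneg (by omega), abs_of_pos (by omega)]; omega
      · rw [uIcc_of_ge h.le]; exact ⟨by omega, by omega⟩
      · have := (hstep k ((p + Pi.single k (-1)) +ᵥ x)).symm
        have he : (Pi.single k 1 : Fin d → ℤ) + (p + Pi.single k (-1)) = p := by
          rw [Pi.single_neg]; abel
        rw [← add_vadd, he] at this
        exact this.mono (inter_subset_right.trans (hV p left_mem_uIcc))

theorem exists_isLatticeLike_schreierGraph {S : Set (Fin d → ℤ)} (hfin : S.Finite)
    (hgen : AddSubgroup.closure S = ⊤) :
    ∃ c : ℤ, IsLatticeLike d (schreierGraph X S) c := by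
  choose r hr hrx using fun k : Fin d =>
    exists_reachableIn_cube (X := X) hgen (Pi.single k 1 : Fin d → ℤ)
  choose t ht hts using fun s : Fin d → ℤ => exists_forall_abs_le s
  have hrc : ∀ k, r k ≤ ∑ k, r k := fun k =>
    Finset.single_le_sum (fun k _ => hr k) (Finset.mem_univ k)
  obtain ⟨B, hB⟩ := (hfin.image t).bddAbove
  have hSc : ∀ s ∈ S, t s ≤ max B 0 := fun s hs =>
    (hB (mem_image_of_mem t hs)).trans (le_max_left _ _)
  have h0 : 0 ≤ ∑ k, r k := Finset.sum_nonneg fun k _ => hr k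
  have h1 : 0 ≤ max B 0 := le_max_right _ _
  have habs : ∀ k j : Fin d, |(Pi.single k 1 : Fin d → ℤ) j| ≤ 1 := fun k j => by
    by_cases h : j = k
    · subst h; simp
    · simp [h]
  refine ⟨max B 0 + ∑ k, r k + 1, isLatticeLike_of_unit_steps (by linarith) ?_ ?_⟩
  · intro x y hxy
    have hmem : ∀ s ∈ S, ∀ z : X, s +ᵥ z ∈ cube d (max B 0 + ∑ k, r k + 1) z := fun s hs z =>
      ⟨s, fun k => (hts s k).trans (by linarith [hSc s hs]), rfl⟩
    rcases ((SimpleGraph.fromRel_adj _ _ _).1 hxy).2 with ⟨s, hs, rfl⟩ | ⟨s, hs, rfl⟩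
    · exact hmem s hs x
    · exact mem_cube_symm (hmem s hs y)
  · intro k x
    refine (hrx k x).mono (subset_inter (cube_mono (by linarith [hrc k])) fun y hy => ?_)
    exact cube_mono (by linarith [hrc k])
      (mem_cube_trans (mem_cube_symm ⟨_, habs k, rfl⟩) hy)

end Schreier

namespace IsLatticeLike

variable {d : ℕ} {X : Type*} [AddAction (Fin d → ℤ) X] {G : SimpleGraph X} {c : ℤ}

/-- A cube is connected inside its thickening by `c`. -/
theorem reachableIn_of_mem_cube (hG : IsLatticeLike d G c) {r : ℤ} {x y y' : X} {V : Set X}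
    (hV : ∀ z ∈ cube d r x, cube d c z ⊆ V) (hy : y ∈ cube d r x) (hy' : y' ∈ cube d r x) :
    G.ReachableIn V y y' := by
  obtain ⟨p, hp, rfl⟩ := hy
  obtain ⟨q, hq, rfl⟩ := hy'
  refine hG.reachableIn p q x V fun v hv => hV _ ⟨v, abs_apply_le_of_mem_uIcc hp hq hv, rfl⟩

/-- In dimension at least two, the shell between two cubes is connected inside its thickening
by `c`: keeping one large coordinate fixed, all other coordinates can be changed freely. -/
theorem reachableIn_of_mem_shell (hG : IsLatticeLike d G c) (hd : 2 ≤ d)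
    (hfree : ∀ (g : Fin d → ℤ) (x : X), g +ᵥ x = x → g = 0) {r R : ℤ} (hr : 0 ≤ r) (hrR : r < R)
    {x y y' : X} {V : Set X}
    (hV : ∀ z ∈ cube d R x \ cube d r x, cube d c z ⊆ V) (hy : y ∈ cube d R x \ cube d r x)
    (hy' : y' ∈ cube d R x \ cube d r x) : G.ReachableIn V y y' := by
  -- changing the coordinates other than `k`, where `p k` is large
  have hmove : ∀ (p q : Fin d → ℤ) (k : Fin d), (∀ j, |p j| ≤ R) → (∀ j, |q j| ≤ R) →
      p k = q k → r < |p k| → G.ReachableIn V (p +ᵥ x) (q +ᵥ x) := by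
    intro p q k hp hq hpq hk
    refine hG.reachableIn p q x V fun v hv =>
      hV _ ⟨⟨v, abs_apply_le_of_mem_uIcc hp hq hv, rfl⟩, ?_⟩
    rintro ⟨w, hw, hwv⟩
    have hwv' : w = v := (vadd_eq_vadd_iff_of_free hfree).1 hwv
    subst hwv'
    have := apply_mem_uIcc hv k
    rw [hpq, uIcc_self, mem_singleton_iff] at this
    have h2 := hw k
    rw [this, ← hpq] at h2
    omega
  -- every point of the shell is joined to the corner with all coordinates equal to `R`
  have hcorner : ∀ z ∈ cube d R x \ cube d r x,
      G.ReachableIn V z ((fun _ => R : Fin d → ℤ) +ᵥ x) := by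
    rintro _ ⟨⟨p, hp, rfl⟩, hz⟩
    have : ∃ k, r < |p k| := by
      by_contra! h
      exact hz ⟨p, h, rfl⟩
    obtain ⟨k, hk⟩ := this
    obtain ⟨j, hj⟩ : ∃ j : Fin d, j ≠ k := by
      have := Fin.nontrivial_iff_two_le.2 hd
      exact exists_ne k
    have hR : |R| = R := abs_of_pos (by omega)
    have hp' : ∀ i, |Function.update (fun _ => R : Fin d → ℤ) k (p k) i| ≤ R := fun i => by
      by_cases hi : i = k
      · subst hi; simpa using hp i
      · simp [hi, hR]
    refine (hmove p (Function.update (fun _ => R) k (p k)) k hp hp' (by simp) hk).trans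
      (hmove _ _ j hp' (fun _ => hR.le) (by simp [hj]) ?_)
    simpa [hj, hR] using hrR
  exact (hcorner y hy).trans (hcorner y' hy').symm

end IsLatticeLike

/-! ### Construction of the tiles -/

section Construction

variable (d : ℕ) {X : Type*} [AddAction (Fin d → ℤ) X]

/-- The points of the orbits at distance at most `r` from the set `U`. -/
def cubeThickening (r : ℤ) (U : Set X) : Set X := ⋃ x ∈ U, cube d r x

/-- Enlarge `U` by the cubes of radius `9 * s m` around those marker points of level `m` for which
this cube meets the set built so far, for `m = j - 1, …, 0` in decreasing order. -/
def absorb (s : ℕ → ℤ) (C : ℕ → Set X) : ℕ → Set X → Set X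
  | 0, U => U
  | j + 1, U => absorb s C j
      (U ∪ ⋃ w ∈ C j, ⋃ _ : (cube d (9 * s j) w ∩ U).Nonempty, cube d (9 * s j) w)

/-- The core of the tile of level `i` at `z`: a cube which has absorbed the neighbourhoods of all
nearby tiles of lower levels. -/
def tileCore (s : ℕ → ℤ) (C : ℕ → Set X) (i : ℕ) (z : X) : Set X :=
  absorb d s C i (cube d (3 * s i) z)

/-- The connected component of `z` in the thickened core. -/
def tileBody (G : SimpleGraph X) (c : ℤ) (s : ℕ → ℤ) (C : ℕ → Set X) (i : ℕ) (z : X) : Set X :=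
  {p | G.ReachableIn (cubeThickening d c (tileCore d s C i z)) z p}

/-- The collar of the tile of level `i` at `z`: everything in a large cube that can be reached
from the outer shell of this cube without entering the body of the tile. -/
def tileCollar (G : SimpleGraph X) (c : ℤ) (s : ℕ → ℤ) (C : ℕ → Set X) (i : ℕ) (z : X) :
    Set X :=
  {p | ∃ q ∈ cube d (6 * s i) z \ cube d (5 * s i) z,
    G.ReachableIn (cube d (7 * s i) z \ tileBody d G c s C i z) q p}

/-- The tile of level `i` at `z`: the body together with all points that it cuts off from the
outer shell. -/
def tile (G : SimpleGraph X) (c : ℤ) (s : ℕ → ℤ) (C : ℕ → Set X) (i : ℕ) (z : X) : Set X :=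
  cube d (5 * s i) z \ tileCollar d G c s C i z

/-- The collection of all tiles at marker points. -/
def tiles (G : SimpleGraph X) (c : ℤ) (s : ℕ → ℤ) (C : ℕ → Set X) : Set (Set X) :=
  {K | ∃ i, ∃ z ∈ C i, K = tile d G c s C i z}

/-- What remains of the tile of level `i` at `z` after removal of the tiles inside it whose level
is at least `m` and less than `i`. -/
def tileRemainder (G : SimpleGraph X) (c : ℤ) (s : ℕ → ℤ) (C : ℕ → Set X) (i : ℕ) (z : X)
    (m : ℕ) : Set X :=
  {p | p ∈ tile d G c s C i z ∧ ∀ j w, m ≤ j → j < i → w ∈ C j →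
    tile d G c s C j w ⊆ tile d G c s C i z → p ∉ tile d G c s C j w}

/-- The assumptions under which the tiles form a connected toast, apart from covering all
edges: the graph resembles the lattice, the action is free, the scales grow fast, and the marker
points of each level are far apart. -/
structure IsMarkerSystem (G : SimpleGraph X) (c : ℤ) (s : ℕ → ℤ) (C : ℕ → Set X) : Prop where
  lattice : IsLatticeLike d G c
  two_le : 2 ≤ d
  free : ∀ (g : Fin d → ℤ) (x : X), g +ᵥ x = x → g = 0
  le_scale : ∀ i, 5 * c ≤ s i
  growth : ∀ i, 100 * s i ≤ s (i + 1)
  separated : ∀ i, ∀ x ∈ C i, ∀ y ∈ C i, y ∈ cube d (20 * s i) x → x = y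

end Construction

namespace IsMarkerSystem

variable {d : ℕ} {X : Type*} [AddAction (Fin d → ℤ) X] {G : SimpleGraph X} {c : ℤ} {s : ℕ → ℤ}
  {C : ℕ → Set X}

theorem scale_pos (M : IsMarkerSystem d G c s C) (i : ℕ) : 0 < s i := by
  linarith [M.le_scale i, M.lattice.pos]

theorem scale_lt (M : IsMarkerSystem d G c s C) {i j : ℕ} (h : j < i) : 100 * s j ≤ s i := by
  induction i, h using Nat.le_induction with
  | base => exact M.growth j
  | succ i _ ih => linarith [M.growth i, M.scale_pos i]

theorem sum_scale_le (M : IsMarkerSystem d G c s C) (j : ℕ) :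
    5 * (18 * ∑ m ∈ Finset.range j, s m) ≤ s j := by
  induction j with
  | zero => simpa using (M.scale_pos 0).le
  | succ j ih =>
    rw [Finset.sum_range_succ]
    linarith [M.growth j, M.scale_pos j]

theorem subset_absorb (j : ℕ) (U : Set X) : U ⊆ absorb d s C j U := by
  induction j generalizing U with
  | zero => exact Subset.rfl
  | succ j ih => exact subset_union_left.trans (ih _)

theorem absorb_subset (M : IsMarkerSystem d G c s C) (j : ℕ) (U : Set X) {p : X}
    (hp : p ∈ absorb d s C j U) : ∃ u ∈ U, p ∈ cube d (18 * ∑ m ∈ Finset.range j, s m) u := by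
  induction j generalizing U with
  | zero => exact ⟨p, hp, mem_cube_self (by simp)⟩
  | succ j ih =>
    obtain ⟨u, hu, hpu⟩ := ih _ hp
    rw [Finset.sum_range_succ]
    rcases hu with hu | hu
    · exact ⟨u, hu, cube_mono (by linarith [M.scale_pos j]) hpu⟩
    · simp only [mem_iUnion] at hu
      obtain ⟨w, -, ⟨r, hrw, hr⟩, huw⟩ := hu
      exact ⟨r, hr, cube_mono (by linarith)
        (mem_cube_trans (mem_cube_trans (mem_cube_symm hrw) huw) hpu)⟩

/-- Around a marker point of a lower level, the absorbing set either contains a large cube or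
avoids a slightly smaller one. -/
theorem absorb_dichotomy (M : IsMarkerSystem d G c s C) {j k : ℕ} (hjk : j < k) (U : Set X)
    {w : X} (hw : w ∈ C j) :
    cube d (9 * s j) w ⊆ absorb d s C k U ∨ ∀ p ∈ absorb d s C k U, p ∉ cube d (8 * s j + c) w := by
  induction k generalizing U with
  | zero => omega
  | succ k ih =>
    rcases Nat.lt_succ_iff_lt_or_eq.1 hjk with h | rfl
    · exact ih h _
    by_cases hU : (cube d (9 * s j) w ∩ U).Nonempty
    · refine Or.inl (Subset.trans (fun p hp => Or.inr ?_) (subset_absorb j _))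
      simp only [mem_iUnion]
      exact ⟨w, hw, hU, hp⟩
    · refine Or.inr fun p hp hpw => hU ?_
      obtain ⟨u, hu, hpu⟩ := M.absorb_subset j _ hp
      have huw := mem_cube_trans hpw (mem_cube_symm hpu)
      have h1 := M.sum_scale_le j
      have h2 := M.le_scale j
      have h3 := M.scale_pos j
      rcases hu with hu | hu
      · exact ⟨u, cube_mono (by linarith) huw, hu⟩
      · simp only [mem_iUnion] at hu
        obtain ⟨w', hw', hw'U, huw'⟩ := hu
        -- distinct marker points of the same level are too far apart to interact
        obtain rfl := M.separated j w hw w' hw'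
          (cube_mono (by linarith) (mem_cube_trans huw (mem_cube_symm huw')))
        exact hw'U

theorem cube_subset_core (i : ℕ) (z : X) : cube d (3 * s i) z ⊆ tileCore d s C i z :=
  subset_absorb i _

theorem mem_core_self (M : IsMarkerSystem d G c s C) (i : ℕ) (z : X) : z ∈ tileCore d s C i z :=
  cube_subset_core i z (mem_cube_self (by linarith [M.scale_pos i]))

theorem core_subset (M : IsMarkerSystem d G c s C) (i : ℕ) (z : X) :
    tileCore d s C i z ⊆ cube d (4 * s i - c) z := fun p hp => by
  obtain ⟨u, hu, hpu⟩ := M.absorb_subset i _ hp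
  exact cube_mono (by linarith [M.sum_scale_le i, M.le_scale i, M.scale_pos i])
    (mem_cube_trans hu hpu)

theorem subset_thickening (hc : 0 ≤ c) (U : Set X) : U ⊆ cubeThickening d c U := fun _ hp =>
  mem_iUnion₂.2 ⟨_, hp, mem_cube_self hc⟩

theorem reachableIn_thickening_absorb (hG : IsLatticeLike d G c) (j : ℕ) {U : Set X} {z : X}
    (hU : ∀ p ∈ U, G.ReachableIn (cubeThickening d c U) z p) :
    ∀ p ∈ absorb d s C j U, G.ReachableIn (cubeThickening d c (absorb d s C j U)) z p := by
  induction j generalizing U with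
  | zero => exact hU
  | succ j ih =>
    refine ih fun p hp => ?_
    have hmono : ∀ {W W' : Set X}, W ⊆ W' → cubeThickening d c W ⊆ cubeThickening d c W' :=
      fun h => biUnion_subset_biUnion_left h
    rcases hp with hp | hp
    · exact (hU p hp).mono (hmono subset_union_left)
    · have hp' := hp
      simp only [mem_iUnion] at hp
      obtain ⟨w, hw, ⟨r, hrw, hr⟩, hpw⟩ := hp
      refine ((hU r hr).mono (hmono subset_union_left)).trans
        (hG.reachableIn_of_mem_cube (fun y hy => ?_) hrw hpw)
      refine subset_biUnion_of_mem (u := fun x => cube d c x) (Or.inr ?_)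
      simp only [mem_iUnion]
      exact ⟨w, hw, ⟨r, hrw, hr⟩, hy⟩

theorem core_subset_body (M : IsMarkerSystem d G c s C) (i : ℕ) (z : X) :
    tileCore d s C i z ⊆ tileBody d G c s C i z := by
  refine reachableIn_thickening_absorb M.lattice i fun p hp => ?_
  refine M.lattice.reachableIn_of_mem_cube (fun y hy => ?_)
    (mem_cube_self (by linarith [M.scale_pos i])) hp
  exact subset_biUnion_of_mem (u := fun x => cube d c x) hy

theorem body_subset_thickening (M : IsMarkerSystem d G c s C) (i : ℕ) (z : X) :
    tileBody d G c s C i z ⊆ cubeThickening d c (tileCore d s C i z) := fun _ hp =>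
  ReachableIn.mem hp (subset_thickening M.lattice.pos.le _ (M.mem_core_self i z))

theorem body_subset (M : IsMarkerSystem d G c s C) (i : ℕ) (z : X) :
    tileBody d G c s C i z ⊆ cube d (4 * s i) z := fun p hp => by
  obtain ⟨u, hu, hpu⟩ := mem_iUnion₂.1 (M.body_subset_thickening i z hp)
  exact cube_mono (by linarith) (mem_cube_trans (M.core_subset i z hu) hpu)

theorem reachableIn_body {i : ℕ} {z p : X}
    (hp : p ∈ tileBody d G c s C i z) : G.ReachableIn (tileBody d G c s C i z) z p :=
  (ReachableIn.of_closed (fun _ hx _ hxy hx' hy' => hx.trans (ReachableIn.single hxy hx' hy'))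
    hp ReachableIn.refl).1

theorem shell_subset_collar (i : ℕ) (z : X) :
    cube d (6 * s i) z \ cube d (5 * s i) z ⊆ tileCollar d G c s C i z := fun q hq =>
  ⟨q, hq, ReachableIn.refl⟩

theorem collar_subset (M : IsMarkerSystem d G c s C) (i : ℕ) (z : X) :
    tileCollar d G c s C i z ⊆ cube d (7 * s i) z \ tileBody d G c s C i z := by
  rintro p ⟨q, hq, hqp⟩
  have h := M.scale_pos i
  exact hqp.mem ⟨cube_mono (by linarith) hq.1,
    fun hb => hq.2 (cube_mono (by linarith) (M.body_subset i z hb))⟩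

theorem collar_closed {i : ℕ} {z a b : X} (ha : a ∈ tileCollar d G c s C i z) (hab : G.Adj a b)
    (ha' : a ∈ cube d (7 * s i) z \ tileBody d G c s C i z)
    (hb : b ∈ cube d (7 * s i) z \ tileBody d G c s C i z) : b ∈ tileCollar d G c s C i z := by
  obtain ⟨q, hq, hqa⟩ := ha
  exact ⟨q, hq, hqa.trans (ReachableIn.single hab ha' hb)⟩

theorem reachableIn_collar (M : IsMarkerSystem d G c s C) {i : ℕ} {z a b : X}
    (ha : a ∈ tileCollar d G c s C i z) (hb : b ∈ tileCollar d G c s C i z) :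
    G.ReachableIn (tileCollar d G c s C i z) a b := by
  obtain ⟨q, hq, hqa⟩ := ha
  obtain ⟨q', hq', hqb⟩ := hb
  have h1 := M.le_scale i
  have h2 := M.scale_pos i
  have hqq' : G.ReachableIn (cube d (7 * s i) z \ tileBody d G c s C i z) q q' := by
    refine M.lattice.reachableIn_of_mem_shell M.two_le M.free (by linarith) (by linarith)
      (fun y hy p hp => ⟨cube_mono (by linarith) (mem_cube_trans hy.1 hp), fun hpb => hy.2 ?_⟩)
      hq hq'
    exact cube_mono (by linarith) (mem_cube_trans (M.body_subset i z hpb) (mem_cube_symm hp))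
  have key : ∀ {p}, G.ReachableIn (cube d (7 * s i) z \ tileBody d G c s C i z) q p →
      G.ReachableIn (tileCollar d G c s C i z) q p := fun h =>
    (h.of_closed (fun x hx y hxy hx' hy' => collar_closed hx hxy hx' hy')
      (shell_subset_collar i z hq)).1
  exact (key hqa).symm.trans (key (hqq'.trans hqb))

theorem body_subset_tile (M : IsMarkerSystem d G c s C) (i : ℕ) (z : X) :
    tileBody d G c s C i z ⊆ tile d G c s C i z := fun _ hp =>
  ⟨cube_mono (by linarith [M.scale_pos i]) (M.body_subset i z hp),
    fun h => (M.collar_subset i z h).2 hp⟩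

theorem cube_subset_tile (M : IsMarkerSystem d G c s C) (i : ℕ) (z : X) :
    cube d (3 * s i) z ⊆ tile d G c s C i z :=
  (cube_subset_core i z).trans ((M.core_subset_body i z).trans (M.body_subset_tile i z))

theorem mem_tile_self (M : IsMarkerSystem d G c s C) (i : ℕ) (z : X) : z ∈ tile d G c s C i z :=
  M.cube_subset_tile i z (mem_cube_self (by linarith [M.scale_pos i]))

theorem tile_subset_cube (M : IsMarkerSystem d G c s C) (i : ℕ) (z : X) :
    tile d G c s C i z ⊆ cube d (7 * s i) z := fun _ hp =>
  cube_mono (by linarith [M.scale_pos i]) hp.1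

theorem collar_nonempty (M : IsMarkerSystem d G c s C) (i : ℕ) (z : X) :
    (tileCollar d G c s C i z).Nonempty := by
  have h := M.scale_pos i
  have hd : 0 < d := by linarith [M.two_le]
  refine ⟨(fun _ => 6 * s i : Fin d → ℤ) +ᵥ z, shell_subset_collar i z
    ⟨⟨_, fun _ => (abs_of_pos (by linarith)).le, rfl⟩, ?_⟩⟩
  rintro ⟨v, hv, hvz⟩
  have hv' := (vadd_eq_vadd_iff_of_free M.free).1 hvz
  have := hv ⟨0, hd⟩
  rw [hv'] at this
  linarith [le_abs_self (6 * s i)]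

/-- All neighbours of a tile are in the tile or in its collar, as the outer shell is too thick to
be crossed by an edge. -/
theorem mem_tile_or_collar_of_adj (M : IsMarkerSystem d G c s C) {i : ℕ} {z a b : X}
    (ha : a ∈ tile d G c s C i z) (hab : G.Adj a b) :
    b ∈ tile d G c s C i z ∪ tileCollar d G c s C i z := by
  by_cases hb : b ∈ tileCollar d G c s C i z
  · exact Or.inr hb
  refine Or.inl ⟨?_, hb⟩
  by_contra hb5
  refine hb (shell_subset_collar i z ⟨?_, hb5⟩)
  exact cube_mono (by linarith [M.le_scale i, M.scale_pos i, M.lattice.pos])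
    (mem_cube_trans ha.1 (M.lattice.mem_cube_of_adj a b hab))

/-- A path that avoids the body of a tile and stays in its large cube does not leave the set of
points cut off by the body. -/
theorem mem_tile_of_reachableIn (M : IsMarkerSystem d G c s C) {i : ℕ} {z a b : X}
    (ha : a ∈ tile d G c s C i z)
    (hab : G.ReachableIn (cube d (7 * s i) z \ tileBody d G c s C i z) a b) :
    b ∈ tile d G c s C i z := by
  refine (hab.of_closed (fun x hx y hxy hx' hy' => ?_) ha).2
  rcases M.mem_tile_or_collar_of_adj hx hxy with h | h
  · exact h
  · exact (hx.2 (collar_closed h hxy.symm hy' hx')).elim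

theorem reachableIn_tile (M : IsMarkerSystem d G c s C) {i : ℕ} {z a : X}
    (ha : a ∈ tile d G c s C i z) : G.ReachableIn (tile d G c s C i z) a z := by
  have h1 := M.le_scale i
  have h2 := M.scale_pos i
  have hpath : G.ReachableIn (cube d (7 * s i) z) a z :=
    M.lattice.reachableIn_of_mem_cube
      (fun y hy p hp => cube_mono (by linarith) (mem_cube_trans hy hp)) ha.1
      (mem_cube_self (by linarith))
  induction hpath using Relation.ReflTransGen.head_induction_on with
  | refl => exact ReachableIn.refl
  | @head a b h _ ih =>
    by_cases hb : a ∈ tileBody d G c s C i z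
    · exact ((reachableIn_body hb).mono (M.body_subset_tile i z)).symm
    · rcases M.mem_tile_or_collar_of_adj ha h.1 with h' | h'
      · exact (ReachableIn.single h.1 ha h').trans (ih h')
      · exact (ha.2 (collar_closed h' h.1.symm (M.collar_subset i z h') ⟨h.2.1, hb⟩)).elim

/-- Tiles of a lower level are, together with their collars, contained in a given tile or
disjoint from it. -/
theorem cube_subset_tile_or_disjoint (M : IsMarkerSystem d G c s C) {i j : ℕ} (hji : j < i)
    (z : X) {w : X} (hw : w ∈ C j) :
    cube d (7 * s j) w ⊆ tile d G c s C i z ∨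
      Disjoint (cube d (7 * s j) w) (tile d G c s C i z) := by
  have h1 := M.le_scale j
  have h2 := M.scale_pos j
  have h3 := M.scale_lt hji
  have h4 := M.lattice.pos
  rcases M.absorb_dichotomy hji (cube d (3 * s i) z) hw with h | h
  · exact Or.inl ((cube_mono (by linarith)).trans
      (h.trans ((M.core_subset_body i z).trans (M.body_subset_tile i z))))
  -- now the body avoids a cube around `w`, and either cuts off all of it or none of it
  refine or_iff_not_imp_right.2 fun hnd q hq => ?_
  obtain ⟨p, hpw, hp⟩ := not_disjoint_iff.1 hnd
  refine M.mem_tile_of_reachableIn hp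
    (M.lattice.reachableIn_of_mem_cube (fun y hy a ha => ?_) hpw hq)
  have haw := mem_cube_trans hy ha
  refine ⟨cube_mono (by linarith)
    (mem_cube_trans hp.1 (mem_cube_trans (mem_cube_symm hpw) haw)), fun hab => ?_⟩
  obtain ⟨u, hu, hau⟩ := mem_iUnion₂.1 (M.body_subset_thickening i z hab)
  exact h u hu (cube_mono (by linarith) (mem_cube_trans haw (mem_cube_symm hau)))

theorem disjoint_cube (M : IsMarkerSystem d G c s C) {i : ℕ} {z w : X} (hz : z ∈ C i)
    (hw : w ∈ C i) (hzw : z ≠ w) : Disjoint (cube d (7 * s i) z) (cube d (7 * s i) w) :=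
  disjoint_left.2 fun _ hp hp' => hzw (M.separated i z hz w hw
    (cube_mono (by linarith [M.scale_pos i]) (mem_cube_trans hp (mem_cube_symm hp'))))

/-! ### Connectedness of the remainders -/

/-- The closed neighbourhood of a tile lies in its large cube. -/
theorem closedNeighborhood_tile_subset (M : IsMarkerSystem d G c s C) (i : ℕ) (z : X) :
    closedNeighborhood G (tile d G c s C i z) ⊆ cube d (7 * s i) z := by
  rintro y (hy | ⟨x, hx, hxy⟩)
  · exact M.tile_subset_cube i z hy
  · rcases M.mem_tile_or_collar_of_adj hx hxy with h | h
    · exact M.tile_subset_cube i z h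
    · exact (M.collar_subset i z h).1

/-- A tile of level `m` that is not inside a removed tile of higher level can be bypassed in the
remainder through its collar. -/
theorem collar_subset_remainder (M : IsMarkerSystem d G c s C) {i m : ℕ} (hm : m < i) {z w v : X}
    (hw : w ∈ C m) (hv : v ∈ tileRemainder d G c s C i z (m + 1))
    (hvw : v ∈ tile d G c s C m w) :
    tileCollar d G c s C m w ⊆ tileRemainder d G c s C i z m := by
  intro p hp
  have hp7 := (M.collar_subset m w hp).1
  have hv7 := M.tile_subset_cube m w hvw
  refine ⟨?_, fun j w' hmj hji hw' hsub hpw' => ?_⟩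
  · rcases M.cube_subset_tile_or_disjoint hm z hw with h | h
    · exact h hp7
    · exact (disjoint_left.1 h hv7 hv.1).elim
  · rcases hmj.eq_or_lt with rfl | hmj
    · by_cases hww : w = w'
      · subst hww
        exact hpw'.2 hp
      · exact disjoint_left.1 (M.disjoint_cube hw hw' hww) hp7 (M.tile_subset_cube m w' hpw')
    · rcases M.cube_subset_tile_or_disjoint hmj w' hw with h | h
      · exact hv.2 j w' hmj hji hw' hsub (h hv7)
      · exact disjoint_left.1 h hp7 hpw'

theorem remainder_subset_remainder (i m : ℕ) (z : X) :
    tileRemainder d G c s C i z m ⊆ tileRemainder d G c s C i z (m + 1) := fun _ hp =>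
  ⟨hp.1, fun j w hj => hp.2 j w (by omega)⟩

/-- A point of a remainder either survives the next removal, or lies in a tile that is removed. -/
theorem mem_remainder_or {i m : ℕ} {z v : X}
    (hv : v ∈ tileRemainder d G c s C i z (m + 1)) :
    v ∈ tileRemainder d G c s C i z m ∨ ∃ w ∈ C m,
      tile d G c s C m w ⊆ tile d G c s C i z ∧ v ∈ tile d G c s C m w := by
  refine or_iff_not_imp_right.2 fun h => ⟨hv.1, fun j w hmj hji hw hsub hvw => ?_⟩
  rcases hmj.eq_or_lt with rfl | hmj
  · exact h ⟨w, hw, hsub, hvw⟩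
  · exact hv.2 j w hmj hji hw hsub hvw

/-- The remainders stay nonempty and connected when the tiles of one more level are removed: each
visit of a path to a removed tile is replaced by a detour through the collar of that tile. -/
theorem remainder_step (M : IsMarkerSystem d G c s C) {i m : ℕ} (hm : m < i) {z : X}
    (hne : (tileRemainder d G c s C i z (m + 1)).Nonempty)
    (hconn : ∀ a ∈ tileRemainder d G c s C i z (m + 1),
      ∀ b ∈ tileRemainder d G c s C i z (m + 1),
        G.ReachableIn (tileRemainder d G c s C i z (m + 1)) a b) :
    (tileRemainder d G c s C i z m).Nonempty ∧ ∀ a ∈ tileRemainder d G c s C i z m,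
      ∀ b ∈ tileRemainder d G c s C i z m,
        G.ReachableIn (tileRemainder d G c s C i z m) a b := by
  constructor
  · obtain ⟨v, hv⟩ := hne
    rcases mem_remainder_or hv with h | ⟨w, hw, -, hvw⟩
    · exact ⟨v, h⟩
    · exact (M.collar_nonempty m w).mono (M.collar_subset_remainder hm hw hv hvw)
  intro a ha b hb
  have key : ∀ v, G.ReachableIn (tileRemainder d G c s C i z (m + 1)) a v →
      (v ∈ tileRemainder d G c s C i z m →
        G.ReachableIn (tileRemainder d G c s C i z m) a v) ∧
      ∀ w ∈ C m, tile d G c s C m w ⊆ tile d G c s C i z → v ∈ tile d G c s C m w →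
        ∀ o ∈ tileCollar d G c s C m w,
          G.ReachableIn (tileRemainder d G c s C i z m) a o := by
    intro v hav
    induction hav with
    | refl =>
      exact ⟨fun _ => ReachableIn.refl, fun w hw hsub haw => (ha.2 m w le_rfl hm hw hsub haw).elim⟩
    | @tail u v _ h ih =>
      obtain ⟨huv, hu, hv⟩ := h
      constructor
      · intro hv'
        rcases mem_remainder_or hu with hu' | ⟨w, hw, hsub, huw⟩
        · exact (ih.1 hu').trans (ReachableIn.single huv hu' hv')
        · rcases M.mem_tile_or_collar_of_adj huw huv with h | h
          · exact (hv'.2 m w le_rfl hm hw hsub h).elim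
          · exact ih.2 w hw hsub huw v h
      · intro w hw hsub hvw o ho
        rcases M.mem_tile_or_collar_of_adj hvw huv.symm with h | h
        · exact ih.2 w hw hsub h o ho
        · have hsub' := M.collar_subset_remainder hm hw hv hvw
          exact (ih.1 (hsub' h)).trans ((M.reachableIn_collar h ho).mono hsub')
  exact (key b (hconn a (remainder_subset_remainder i m z ha) b
    (remainder_subset_remainder i m z hb))).1 hb

theorem remainder_connected (M : IsMarkerSystem d G c s C) (i : ℕ) (z : X) :
    (G.induce (tileRemainder d G c s C i z 0)).Connected := by
  have key : (tileRemainder d G c s C i z 0).Nonempty ∧ ∀ a ∈ tileRemainder d G c s C i z 0,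
      ∀ b ∈ tileRemainder d G c s C i z 0,
        G.ReachableIn (tileRemainder d G c s C i z 0) a b := by
    refine Nat.decreasingInduction (n := i) (motive := fun m _ =>
      (tileRemainder d G c s C i z m).Nonempty ∧ ∀ a ∈ tileRemainder d G c s C i z m,
        ∀ b ∈ tileRemainder d G c s C i z m,
          G.ReachableIn (tileRemainder d G c s C i z m) a b)
      (fun m hm h => M.remainder_step hm h.1 h.2) ?_ (Nat.zero_le i)
    have htop : tileRemainder d G c s C i z i = tile d G c s C i z :=
      Subset.antisymm (fun _ hp => hp.1) fun _ hp =>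
        ⟨hp, fun j _ hij hji => absurd hij (by omega)⟩
    rw [htop]
    exact ⟨⟨z, M.mem_tile_self i z⟩, fun a ha b hb =>
      (M.reachableIn_tile ha).trans (M.reachableIn_tile hb).symm⟩
  exact ReachableIn.induce_connected key.1 key.2

/-! ### The toast properties -/

theorem tile_nested_of_lt (M : IsMarkerSystem d G c s C) {i j : ℕ} (hji : j < i) (z : X) {w : X}
    (hw : w ∈ C j) :
    closedNeighborhood G (tile d G c s C j w) ⊆ tile d G c s C i z ∨
      Disjoint (closedNeighborhood G (tile d G c s C j w)) (tile d G c s C i z) :=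
  (M.cube_subset_tile_or_disjoint hji z hw).imp
    (M.closedNeighborhood_tile_subset j w).trans
    (Disjoint.mono_left (M.closedNeighborhood_tile_subset j w))

theorem disjoint_closedNeighborhood_symm {K L : Set X}
    (h : Disjoint (closedNeighborhood G K) L) : Disjoint (closedNeighborhood G L) K := by
  refine disjoint_left.2 ?_
  rintro y (hy | ⟨x, hx, hxy⟩) hyK
  · exact disjoint_left.1 h (Or.inl hyK) hy
  · exact disjoint_left.1 h (Or.inr ⟨y, hyK, hxy.symm⟩) hx

theorem tiles_nested (M : IsMarkerSystem d G c s C) {K L : Set X} (hK : K ∈ tiles d G c s C)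
    (hL : L ∈ tiles d G c s C) (hKL : K ≠ L) :
    Disjoint (closedNeighborhood G K) L ∨ closedNeighborhood G K ⊆ L ∨
      closedNeighborhood G L ⊆ K := by
  obtain ⟨i, z, hz, rfl⟩ := hK
  obtain ⟨j, w, hw, rfl⟩ := hL
  rcases lt_trichotomy i j with h | rfl | h
  · rcases M.tile_nested_of_lt h w hz with h | h
    · exact Or.inr (Or.inl h)
    · exact Or.inl h
  · have hzw : z ≠ w := fun h => hKL (by rw [h])
    exact Or.inl ((M.disjoint_cube hz hw hzw).mono (M.closedNeighborhood_tile_subset i z)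
      (M.tile_subset_cube i w))
  · rcases M.tile_nested_of_lt h z hw with h | h
    · exact Or.inr (Or.inr h)
    · exact Or.inl (disjoint_closedNeighborhood_symm h)

/-- Only tiles of lower level can be proper subsets of a tile. -/
theorem lt_of_tile_ssubset (M : IsMarkerSystem d G c s C) {i j : ℕ} {z w : X} (hz : z ∈ C i)
    (hw : w ∈ C j) (h : tile d G c s C j w ⊂ tile d G c s C i z) : j < i := by
  by_contra hij
  rcases (not_lt.1 hij).eq_or_lt with rfl | hij
  · have hzw : z ≠ w := fun hzw => h.ne (by rw [hzw])
    exact disjoint_left.1 (M.disjoint_cube hz hw hzw)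
      (M.tile_subset_cube i z (h.subset (M.mem_tile_self i w)))
      (M.tile_subset_cube i w (M.mem_tile_self i w))
  · rcases M.tile_nested_of_lt hij w hz with h' | h'
    · exact h.not_subset (subset_union_left.trans h')
    · exact disjoint_left.1 h' (Or.inl (h.subset (M.mem_tile_self j w))) (M.mem_tile_self j w)

theorem diff_eq_remainder (M : IsMarkerSystem d G c s C) {i : ℕ} {z : X} (hz : z ∈ C i) :
    tile d G c s C i z \ ⋃₀ {L | L ∈ tiles d G c s C ∧ L ⊂ tile d G c s C i z} =
      tileRemainder d G c s C i z 0 := by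
  refine Subset.antisymm (fun p hp => ⟨hp.1, fun j w _ hji hw hsub hpw => ?_⟩)
    fun p hp => ⟨hp.1, ?_⟩
  · refine hp.2 ⟨_, ⟨⟨j, w, hw, rfl⟩, hsub, fun hsup => ?_⟩, hpw⟩
    -- a tile of lower level is a proper subset, since its collar is not empty
    obtain ⟨o, ho⟩ := M.collar_nonempty j w
    rcases M.cube_subset_tile_or_disjoint hji z hw with h | h
    · exact (hsup (h (M.collar_subset j w ho).1)).2 ho
    · exact disjoint_left.1 h (M.tile_subset_cube j w hpw) hp.1
  · rintro ⟨_, ⟨⟨j, w, hw, rfl⟩, hss⟩, hpw⟩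
    exact hp.2 j w (Nat.zero_le j) (M.lt_of_tile_ssubset hz hw hss) hw hss.subset hpw

theorem isConnectedToast [MeasurableSpace X] (M : IsMarkerSystem d G c s C)
    (hborel : IsBorelCollection (tiles d G c s C))
    (hcov : ∀ x, ∃ i, ∃ z ∈ C i, z ∈ cube d (2 * s i) x) :
    IsConnectedToast G (tiles d G c s C) where
  borel := hborel
  finite := by
    rintro _ ⟨i, z, -, rfl⟩
    exact finite_cube.subset (M.tile_subset_cube i z)
  connected := by
    rintro _ ⟨i, z, -, rfl⟩
    exact ReachableIn.induce_connected ⟨z, M.mem_tile_self i z⟩ fun a ha b hb =>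
      (M.reachableIn_tile ha).trans (M.reachableIn_tile hb).symm
  covers := by
    intro x y hxy
    obtain ⟨i, z, hz, hzx⟩ := hcov x
    have h1 := M.le_scale i
    have h2 := M.scale_pos i
    refine ⟨_, ⟨i, z, hz, rfl⟩, M.cube_subset_tile i z ?_, M.cube_subset_tile i z ?_⟩
    · exact cube_mono (by linarith) (mem_cube_symm hzx)
    · exact cube_mono (by linarith)
        (mem_cube_trans (mem_cube_symm hzx) (M.lattice.mem_cube_of_adj x y hxy))
  nested := fun _ hK _ hL hKL => M.tiles_nested hK hL hKL
  connected_diff := by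
    rintro _ ⟨i, z, hz, rfl⟩
    rw [M.diff_eq_remainder hz]
    exact M.remainder_connected i z

end IsMarkerSystem

/-! ### The collection of tiles is Borel -/

section Borel

variable {d : ℕ} {X : Type*} [AddAction (Fin d → ℤ) X] [MeasurableSpace X]

/-- A family of sets `V x`, one for each point `x`, is *orbit-measurable* if it is a Borel
condition on `x` that a given translate of `x` belongs to `V x`. Only the part of `V x` in the
orbit of `x` matters. -/
def OrbitMeasurable (d : ℕ) {X : Type*} [AddAction (Fin d → ℤ) X] [MeasurableSpace X]
    (V : X → Set X) : Prop :=
  ∀ h : Fin d → ℤ, Measurable fun x => h +ᵥ x ∈ V x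

theorem orbitMeasurable_cube (hfree : ∀ (g : Fin d → ℤ) (x : X), g +ᵥ x = x → g = 0) (r : ℤ) :
    OrbitMeasurable d fun x : X => cube d r x := fun h => by
  have : (fun x : X => h +ᵥ x ∈ cube d r x) = fun _ => ∀ k, |h k| ≤ r := by
    ext x
    have := vadd_mem_cube_iff hfree (r := r) (g := 0) (h := h) (x := x)
    rwa [zero_vadd, sub_zero] at this
  rw [this]
  exact measurable_const

theorem OrbitMeasurable.diff {V W : X → Set X} (hV : OrbitMeasurable d V)
    (hW : OrbitMeasurable d W) : OrbitMeasurable d fun x => V x \ W x := fun h =>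
  (hV h).and (hW h).not

theorem OrbitMeasurable.cubeThickening
    (hfree : ∀ (g : Fin d → ℤ) (x : X), g +ᵥ x = x → g = 0) {V : X → Set X}
    (hV : OrbitMeasurable d V) (r : ℤ) :
    OrbitMeasurable d fun x => cubeThickening d r (V x) := fun h => by
  have : (fun x : X => h +ᵥ x ∈ _root_.cubeThickening d r (V x)) =
      fun x => ∃ g : Fin d → ℤ, g +ᵥ x ∈ V x ∧ ∀ k, |(h - g) k| ≤ r := by
    ext x
    simp only [_root_.cubeThickening, mem_iUnion]
    constructor
    · rintro ⟨y, hy, hyx⟩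
      obtain ⟨v, -, hvx⟩ := mem_cube_symm hyx
      rw [← add_vadd] at hvx
      subst hvx
      exact ⟨_, hy, (vadd_mem_cube_iff hfree).1 hyx⟩
    · rintro ⟨g, hg, hgh⟩
      exact ⟨_, hg, (vadd_mem_cube_iff hfree).2 hgh⟩
  rw [this]
  exact Measurable.exists fun g => (hV g).and measurable_const

theorem OrbitMeasurable.absorb (hmeas : ∀ g : Fin d → ℤ, Measurable fun x : X => g +ᵥ x)
    (hfree : ∀ (g : Fin d → ℤ) (x : X), g +ᵥ x = x → g = 0) (s : ℕ → ℤ) {C : ℕ → Set X}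
    (hC : ∀ i, MeasurableSet (C i)) (j : ℕ) {U : X → Set X} (hU : OrbitMeasurable d U) :
    OrbitMeasurable d fun x => absorb d s C j (U x) := by
  induction j generalizing U with
  | zero => exact hU
  | succ j ih =>
    refine ih (U := fun x => U x ∪ ⋃ w ∈ C j, ⋃ _ : (cube d (9 * s j) w ∩ U x).Nonempty,
      cube d (9 * s j) w) fun h => ?_
    have : (fun x : X => h +ᵥ x ∈ U x ∪ ⋃ w ∈ C j, ⋃ _ : (cube d (9 * s j) w ∩ U x).Nonempty,
        cube d (9 * s j) w) = fun x => h +ᵥ x ∈ U x ∨ ∃ g : Fin d → ℤ, g +ᵥ x ∈ C j ∧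
          (∃ k : Fin d → ℤ, (∀ l, |(k - g) l| ≤ 9 * s j) ∧ k +ᵥ x ∈ U x) ∧
            ∀ l, |(h - g) l| ≤ 9 * s j := by
      ext x
      rw [mem_union]
      refine or_congr_right ?_
      simp only [mem_iUnion]
      constructor
      · rintro ⟨w, hw, ⟨r, hrw, hr⟩, hwx⟩
        obtain ⟨v, -, hvx⟩ := mem_cube_symm hwx
        rw [← add_vadd] at hvx
        subst hvx
        have hrw' := hrw
        obtain ⟨u, -, hur⟩ := hrw'
        rw [← add_vadd] at hur
        subst hur
        exact ⟨_, hw, ⟨_, (vadd_mem_cube_iff hfree).1 hrw, hr⟩, (vadd_mem_cube_iff hfree).1 hwx⟩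
      · rintro ⟨g, hg, ⟨k, hk, hkU⟩, hh⟩
        exact ⟨_, hg, ⟨_, (vadd_mem_cube_iff hfree).2 hk, hkU⟩, (vadd_mem_cube_iff hfree).2 hh⟩
    rw [this]
    refine (hU h).or (Measurable.exists fun g => ?_)
    refine (measurableSet_setOfPred.1 (hmeas g (hC j))).and (Measurable.and ?_ measurable_const)
    exact Measurable.exists fun k => measurable_const.and (hU k)

/-- Reachability by paths of a given number of edges, as an auxiliary recursive description. -/
def SimpleGraph.ReachableInSteps {X : Type*} (G : SimpleGraph X) (V : Set X) (a : X) :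
    ℕ → X → Prop
  | 0, b => b = a
  | n + 1, b => ∃ b', G.ReachableInSteps V a n b' ∧ G.Adj b' b ∧ b' ∈ V ∧ b ∈ V

theorem SimpleGraph.reachableIn_iff_exists_steps {X : Type*} {G : SimpleGraph X} {V : Set X}
    {a b : X} : G.ReachableIn V a b ↔ ∃ n, G.ReachableInSteps V a n b := by
  constructor
  · intro h
    induction h with
    | refl => exact ⟨0, rfl⟩
    | tail _ h ih =>
      obtain ⟨n, hn⟩ := ih
      exact ⟨n + 1, _, hn, h⟩
  · rintro ⟨n, hn⟩
    induction n generalizing b with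
    | zero => rw [show b = a from hn]; exact ReachableIn.refl
    | succ n ih =>
      obtain ⟨b', hb', h⟩ := hn
      exact (ih hb').trans (ReachableIn.single h.1 h.2.1 h.2.2)

theorem OrbitMeasurable.reachableIn (hfree : ∀ (g : Fin d → ℤ) (x : X), g +ᵥ x = x → g = 0)
    {G : SimpleGraph X} {c : ℤ} (hG : ∀ x y, G.Adj x y → y ∈ cube d c x)
    (hadj : ∀ g h : Fin d → ℤ, Measurable fun x : X => G.Adj (g +ᵥ x) (h +ᵥ x)) {V : X → Set X}
    (hV : OrbitMeasurable d V) (g h : Fin d → ℤ) :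
    Measurable fun x => G.ReachableIn (V x) (g +ᵥ x) (h +ᵥ x) := by
  simp only [SimpleGraph.reachableIn_iff_exists_steps]
  refine Measurable.exists fun n => ?_
  induction n generalizing h with
  | zero =>
    have : (fun x : X => G.ReachableInSteps (V x) (g +ᵥ x) 0 (h +ᵥ x)) = fun _ => h = g := by
      ext x
      refine ⟨fun hx => ?_, fun hx => congrArg (· +ᵥ x) hx⟩
      exact (vadd_eq_vadd_iff_of_free hfree).1 hx
    rw [this]
    exact measurable_const
  | succ n ih =>
    have : (fun x : X => G.ReachableInSteps (V x) (g +ᵥ x) (n + 1) (h +ᵥ x)) =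
        fun x => ∃ k : Fin d → ℤ, G.ReachableInSteps (V x) (g +ᵥ x) n (k +ᵥ x) ∧
          G.Adj (k +ᵥ x) (h +ᵥ x) ∧ k +ᵥ x ∈ V x ∧ h +ᵥ x ∈ V x := by
      ext x
      constructor
      · rintro ⟨b, hb, hbh, hbV⟩
        obtain ⟨v, -, hvx⟩ := hG _ _ hbh.symm
        rw [← add_vadd] at hvx
        subst hvx
        exact ⟨_, hb, hbh, hbV⟩
      · rintro ⟨k, hk⟩
        exact ⟨_, hk⟩
    rw [this]
    exact Measurable.exists fun k => (ih k).and ((hadj k h).and ((hV k).and (hV h)))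

theorem measurable_adj_schreierGraph
    (hfree : ∀ (g : Fin d → ℤ) (x : X), g +ᵥ x = x → g = 0) (S : Set (Fin d → ℤ))
    (g h : Fin d → ℤ) : Measurable fun x : X => (schreierGraph X S).Adj (g +ᵥ x) (h +ᵥ x) := by
  have : (fun x : X => (schreierGraph X S).Adj (g +ᵥ x) (h +ᵥ x)) =
      fun _ => g ≠ h ∧ ((∃ t ∈ S, t + g = h) ∨ ∃ t ∈ S, t + h = g) := by
    ext x
    simp only [schreierGraph, SimpleGraph.fromRel_adj, ← add_vadd, ne_eq,
      vadd_eq_vadd_iff_of_free hfree]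
  rw [this]
  exact measurable_const

theorem orbitMeasurable_tile (hmeas : ∀ g : Fin d → ℤ, Measurable fun x : X => g +ᵥ x)
    (hfree : ∀ (g : Fin d → ℤ) (x : X), g +ᵥ x = x → g = 0) {G : SimpleGraph X} {c : ℤ}
    (hG : ∀ x y, G.Adj x y → y ∈ cube d c x)
    (hadj : ∀ g h : Fin d → ℤ, Measurable fun x : X => G.Adj (g +ᵥ x) (h +ᵥ x)) (s : ℕ → ℤ)
    {C : ℕ → Set X} (hC : ∀ i, MeasurableSet (C i)) (i : ℕ) :
    OrbitMeasurable d fun x : X => tile d G c s C i x := by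
  have hbody : OrbitMeasurable d fun x : X => tileBody d G c s C i x := fun h => by
    have := (((orbitMeasurable_cube hfree (3 * s i)).absorb hmeas hfree s hC i).cubeThickening
      hfree c).reachableIn hfree hG hadj 0 h
    simp only [zero_vadd] at this
    exact this
  refine (orbitMeasurable_cube hfree _).diff fun h => ?_
  have hreach := ((orbitMeasurable_cube hfree (7 * s i)).diff hbody).reachableIn hfree hG hadj
  have hshell := (orbitMeasurable_cube (X := X) hfree (6 * s i)).diff
    (orbitMeasurable_cube hfree (5 * s i))
  have : (fun x : X => h +ᵥ x ∈ tileCollar d G c s C i x) = fun x => ∃ g : Fin d → ℤ,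
      g +ᵥ x ∈ cube d (6 * s i) x \ cube d (5 * s i) x ∧
        G.ReachableIn (cube d (7 * s i) x \ tileBody d G c s C i x) (g +ᵥ x) (h +ᵥ x) := by
    ext x
    constructor
    · rintro ⟨q, hq, hqh⟩
      obtain ⟨v, -, rfl⟩ := hq.1
      exact ⟨v, hq, hqh⟩
    · rintro ⟨g, hg⟩
      exact ⟨_, hg⟩
  rw [this]
  exact Measurable.exists fun g => (hshell g).and (hreach g h)

theorem isBorelCollection_tiles [StandardBorelSpace X]
    (hmeas : ∀ g : Fin d → ℤ, Measurable fun x : X => g +ᵥ x) {G : SimpleGraph X} {c : ℤ}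
    {s : ℕ → ℤ} {C : ℕ → Set X} (M : IsMarkerSystem d G c s C)
    (hadj : ∀ g h : Fin d → ℤ, Measurable fun x : X => G.Adj (g +ᵥ x) (h +ᵥ x))
    (hC : ∀ i, MeasurableSet (C i)) : IsBorelCollection (tiles d G c s C) := by
  intro n
  have htile := orbitMeasurable_tile hmeas M.free M.lattice.mem_cube_of_adj hadj s hC
  -- the marker point of a tile is one of its elements, hence one of the entries of the tuple
  have : {p : Fin n → X | range p ∈ tiles d G c s C} = {p : Fin n → X |
      ∃ (i : ℕ) (k : Fin n), p k ∈ C i ∧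
        (∀ l, ∃ h : Fin d → ℤ, p l = h +ᵥ p k ∧ h +ᵥ p k ∈ tile d G c s C i (p k)) ∧
        ∀ h : Fin d → ℤ, h +ᵥ p k ∈ tile d G c s C i (p k) → ∃ l, p l = h +ᵥ p k} := by
    ext p
    constructor
    · rintro ⟨i, z, hz, hp⟩
      obtain ⟨k, rfl⟩ : z ∈ range p := hp ▸ M.mem_tile_self i z
      refine ⟨i, k, hz, fun l => ?_, fun h hh => ?_⟩
      · have hl : p l ∈ tile d G c s C i (p k) := hp ▸ mem_range_self l
        obtain ⟨v, -, hv⟩ := M.tile_subset_cube i _ hl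
        exact ⟨v, hv.symm, hv ▸ hl⟩
      · rw [← hp] at hh
        exact hh
    · rintro ⟨i, k, hk, h1, h2⟩
      refine ⟨i, p k, hk, Subset.antisymm ?_ fun y hy => ?_⟩
      · rintro _ ⟨l, rfl⟩
        obtain ⟨h, hl, hh⟩ := h1 l
        rwa [hl]
      · obtain ⟨v, -, rfl⟩ := M.tile_subset_cube i _ hy
        exact h2 v hy
  rw [this]
  have hpk : ∀ k : Fin n, Measurable fun p : Fin n → X => p k := fun k => measurable_pi_apply k
  have heq : ∀ (k l : Fin n) (h : Fin d → ℤ), Measurable fun p : Fin n → X => p l = h +ᵥ p k :=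
    fun k l h => measurableSet_setOfPred.1
      (measurableSet_eq_fun (hpk l) ((hmeas h).comp (hpk k)))
  have hmem : ∀ (i : ℕ) (k : Fin n) (h : Fin d → ℤ),
      Measurable fun p : Fin n → X => h +ᵥ p k ∈ tile d G c s C i (p k) :=
    fun i k h => (htile i h).comp (hpk k)
  refine measurableSet_setOfPred.2 (Measurable.exists fun i => Measurable.exists fun k => ?_)
  refine (measurableSet_setOfPred.1 (hpk k (hC i))).and (Measurable.and ?_ ?_)
  · exact Measurable.forall fun l => Measurable.exists fun h => (heq k l h).and (hmem i k h)
  · exact Measurable.forall fun h => (hmem i k h).imp (Measurable.exists fun l => heq k l h)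

end Borel

/-! ### Existence of the toast -/

theorem mainTheorem6 (d : ℕ) (hd : 2 ≤ d)
    (X : Type*) [MeasurableSpace X] [StandardBorelSpace X]
    [AddAction (Fin d → ℤ) X]
    (hborel : ∀ g : Fin d → ℤ, Measurable (fun x : X => g +ᵥ x))
    (hfree : ∀ (g : Fin d → ℤ) (x : X), g +ᵥ x = x → g = 0)
    (S : Set (Fin d → ℤ)) (hfin : S.Finite) (hgen : AddSubgroup.closure S = ⊤) :
    ∃ T : Set (Set X), IsConnectedToast (schreierGraph X S) T := by
  obtain ⟨c, hG⟩ := exists_isLatticeLike_schreierGraph (X := X) hfin hgen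
  have hc := hG.pos
  let s : ℕ → ℤ := fun i => 5 * c * 100 ^ i
  have hs : ∀ i, 0 < s i := fun i => by positivity
  have hpow : Tendsto (fun i : ℕ => (100 : ℤ) ^ i) atTop atTop :=
    tendsto_pow_atTop_atTop_of_one_lt (by norm_num)
  obtain ⟨C, hCm, hCs, hCc⟩ := exists_marker_sequence hborel hfree hs
    (hpow.const_mul_atTop' (by positivity))
  have M : IsMarkerSystem d (schreierGraph X S) c s C :=
    { lattice := hG
      two_le := hd
      free := hfree
      le_scale := fun i => le_mul_of_one_le_right (by positivity) (one_le_pow₀ (by norm_num))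
      growth := fun i => by simp only [s, pow_succ]; linarith
      separated := hCs }
  exact ⟨_, M.isConnectedToast
    (isBorelCollection_tiles hborel M (measurable_adj_schreierGraph hfree S) hCm)
    fun x => (hCc x).exists⟩
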